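/- Let $f:[0,1]\to[0,1]$ be continuous and suppose that $f$ has a cycle of (least) period $m\cdot p$, where $p>1$ is odd and $m$ is a power of two (possibly $m=1$). Let $\rho>1$ be the root greater than one of $\lambda^{p-1}-\lambda^{p-2}-1=0$. For a threshold $\theta$ and labelled points $(x_i,y_i)_{i=1}^{N}$ with $x_i\in[0,1]$, $y_i\in\{0,1\}$, the classification error of $g:[0,1]\to\mathbb R$ is $$\mathcal R(g)=\frac1N\sum_{i=1}^{N}\mathbf 1\big[\tilde g(x_i)\ne y_i\big],\qquad \tilde g(z)=\mathbf 1[g(z)\ge\theta].$$ A ReLU network with $l\ge1$ layers and $u\ge1$ nodes per layer is a function $g:\mathbb R\to\mathbb R$ obtained by composing $l$ layers of $u$ nodes each, where every node applies $v\mapsto\max(v,0)$ to an affine function of the outputs of the previous layer (of the input, for the first layer), followed by an affine read-out of the last layer. Then there are $a<b$ in $[0,1]$ such that, with the threshold $\theta=\frac{a+b}{2}$, the following holds for every integer $k\ge1$. Put $n=\lfloor\rho^k\rfloor/2$ (so $2n=\lfloor\rho^k\rfloor$ is an integer). There are points $x_1<x_2<\dots<x_{2n}$ in $[0,1]$ with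 labels $y_j=0$ for $j$ odd and $y_j=1$ for $j$ even, where $f^{mk}$ ($f$ composed with itself $mk$ times) takes the value $a$ at the points labelled $0$ and $b$ at the points labelled $1$, such that $\mathcal R(f^{mk})=0$, whereas for all integers $l,u\ge1$ with $u\le\rho^{k/l}/8$, every ReLU network $g$ with $l$ layers and $u$ nodes per layer satisfies $\mathcal R(g)\ge\frac14$. -/

import Mathlib

open scoped unitInterval

noncomputable section

/-- The classifier `𝟏[v ≥ θ]` with threshold `θ`, as a label in `{0, 1}`. -/
def thresholdLabel (θ v : ℝ) : Fin 2 := if θ ≤ v then 1 else 0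

/-- Classification error of `g : [0,1] → ℝ`, thresholded at `θ`, on the labelled points
`(x i, y i)`: the fraction of the points that are misclassified. -/
def classificationError {N : ℕ} (θ : ℝ) (x : Fin N → I) (y : Fin N → Fin 2) (g : I → ℝ) : ℝ :=
  (1 / (N : ℝ)) * ∑ i : Fin N, if thresholdLabel θ (g (x i)) ≠ y i then (1 : ℝ) else 0

/-- Parameters (weights and biases) of `l ≥ 1` successive fully connected layers with `u` nodes
each, on a one-dimensional input. -/
inductive HiddenLayers (u : ℕ) : ℕ → Type
  | first (w b : Fin u → ℝ) : HiddenLayers u 1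
  | next {l : ℕ} (H : HiddenLayers u l) (W : Matrix (Fin u) (Fin u) ℝ) (b : Fin u → ℝ) :
      HiddenLayers u (l + 1)

/-- Outputs of the last layer; every node applies the ReLU activation `v ↦ max v 0` to an affine
function of the outputs of the previous layer. -/
def HiddenLayers.eval {u : ℕ} : {l : ℕ} → HiddenLayers u l → ℝ → Fin u → ℝ
  | _, .first w b, z => fun i => max (w i * z + b i) 0
  | _, .next H W b, z => fun i => max ((∑ j, W i j * H.eval z j) + b i) 0

/-- A ReLU network with scalar input and output, with `l` layers of `u` ReLU nodes each, followed
by an affine read-out. -/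
structure ReLUNetwork (l u : ℕ) where
  hidden : HiddenLayers u l
  c : Fin u → ℝ
  d : ℝ

/-- The function computed by the network. -/
def ReLUNetwork.eval {l u : ℕ} (G : ReLUNetwork l u) (z : ℝ) : ℝ :=
  (∑ i, G.c i * G.hidden.eval z i) + G.d

end

/-! Two counts are compared: the iterates of $f$ oscillate often, and a small network cannot follow.

Dynamics. The map $g=f^m$ has a cycle of odd period $p=q+1$, whose sorted points bound $q$ basic
intervals. Some interval $J=[a,b]$ has endpoints that move past each other, so $J$ covers itself,
and every interval is reached from $J$ in exactly $q-1$ steps (`coverMatrix_pow_pos`). As $p$ is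
odd, the two sides of $J$ cannot be exchanged, so some $v\ne J$ also covers $J$
(`exists_covers_ne`). If $S_k(w)$ counts covering paths of length $k$ ending at $w$, then
$S_{k+1}(J)\ge S_k(J)+S_k(v)$ and $S_{k+q-1}(v)\ge S_k(J)$. This recursion has characteristic
equation $\lambda^q=\lambda^{q-1}+1$, so $S_k(J)\ge\rho^k$ (`pow_le_sum_coverMatrix_pow`). By the
intermediate value theorem each path yields one oscillation of $g^k$ between $a$ and $b$
(`oscillatesOn_iterate`).

Networks. The thresholded output is constant on fewer than $2(u+1)^l+1$ consecutive classes
(`ReLUNetwork.exists_label`), and two neighbouring points in one class cost an error. For $(8u)^l\le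
N$ this spoils a quarter of the $N$ points (`one_fourth_le_classificationError`). -/

/-! ### Piecewise affine structure of ReLU networks -/

/-- A monotone labelling with fewer than `P` labels can be refined so that `u` given predicates,
each monotone or antitone on every label class, become constant on the classes. -/
lemma exists_monotone_label_refinement {α : Type*} [LinearOrder α] {u P : ℕ} {c : α → ℕ}
    (hc : Monotone c) (hP : ∀ z, c z < P) (S : Fin u → α → Prop)
    (hS : ∀ i j, MonotoneOn (S i) {z | c z = j} ∨ AntitoneOn (S i) {z | c z = j}) :
    ∃ c' : α → ℕ, Monotone c' ∧ (∀ z, c' z < P * (u + 1)) ∧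
      ∀ z z', c' z = c' z' → c z = c z' ∧ ∀ i, (S i z ↔ S i z') := by
  classical
  -- Predicates that are not monotone on the class are negated, so `B` only grows along each class.
  -- Nested finite sets are determined by their cardinality, which is at most `u`.
  let B : α → Finset (Fin u) := fun z =>
    {i | if MonotoneOn (S i) {w | c w = c z} then S i z else ¬ S i z}
  have hB : ∀ z z', z ≤ z' → c z = c z' → B z ⊆ B z' := by
    intro z z' hz hcz i hi
    simp only [B, Finset.mem_filter, Finset.mem_univ, true_and] at hi ⊢
    rw [← hcz]
    by_cases hm : MonotoneOn (S i) {w | c w = c z}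
    · rw [if_pos hm] at hi ⊢
      exact hm (by simp) (by simp [hcz]) hz hi
    · rw [if_neg hm] at hi ⊢
      have ha := (hS i (c z)).resolve_left hm
      exact fun h => hi (ha (by simp) (by simp [hcz]) hz h)
  have hcard : ∀ z, (B z).card ≤ u := fun z => by
    simpa using Finset.card_le_univ (B z)
  have key : ∀ z z', z ≤ z' → c z * (u + 1) + (B z).card = c z' * (u + 1) + (B z').card →
      c z = c z' ∧ ∀ i, (S i z ↔ S i z') := by
    intro z z' hz h
    have hcz : c z = c z' := by
      rcases (hc hz).lt_or_eq with hlt | heq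
      · have h1 := hcard z
        have h2 : (c z + 1) * (u + 1) ≤ c z' * (u + 1) := Nat.mul_le_mul_right _ hlt
        rw [add_mul] at h2
        omega
      · exact heq
    refine ⟨hcz, fun i => ?_⟩
    rw [hcz] at h
    have hBB : B z = B z' := Finset.eq_of_subset_of_card_le (hB z z' hz hcz) (by omega)
    have hi : i ∈ B z ↔ i ∈ B z' := by rw [hBB]
    simp only [B, Finset.mem_filter, Finset.mem_univ, true_and, hcz] at hi
    split_ifs at hi with hm
    · exact hi
    · exact not_iff_not.mp hi
  -- Base `u + 1` encoding: the label determines both the old class and the size of `B`.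
  refine ⟨fun z => c z * (u + 1) + (B z).card, ?_, ?_, ?_⟩
  · intro z z' hz
    rcases (hc hz).lt_or_eq with hlt | heq
    · have h1 := hcard z
      have h2 : (c z + 1) * (u + 1) ≤ c z' * (u + 1) := Nat.mul_le_mul_right _ hlt
      rw [add_mul] at h2
      change c z * (u + 1) + (B z).card ≤ c z' * (u + 1) + (B z').card
      omega
    · have := Finset.card_le_card (hB z z' hz heq)
      change c z * (u + 1) + (B z).card ≤ c z' * (u + 1) + (B z').card
      rw [heq]
      omega
  · intro z
    have h1 := hcard z
    have h2 : (c z + 1) * (u + 1) ≤ P * (u + 1) := Nat.mul_le_mul_right _ (hP z)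
    rw [add_mul] at h2
    change c z * (u + 1) + (B z).card < _
    omega
  · intro z z' h
    rcases le_total z z' with hz | hz
    · exact key z z' hz h
    · obtain ⟨h1, h2⟩ := key z' z hz h.symm
      exact ⟨h1.symm, fun i => (h2 i).symm⟩

lemma monotoneOn_or_antitoneOn_le_affine {s : Set ℝ} {g : ℝ → ℝ} {α β : ℝ} (θ : ℝ)
    (hg : ∀ z ∈ s, g z = α * z + β) :
    MonotoneOn (fun z => θ ≤ g z) s ∨ AntitoneOn (fun z => θ ≤ g z) s := by
  rcases le_total 0 α with hα | hα
  · left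
    intro z hz z' hz' hzz (h : θ ≤ g z)
    rw [hg z hz] at h
    rw [hg z' hz']
    nlinarith [mul_le_mul_of_nonneg_left hzz hα]
  · right
    intro z hz z' hz' hzz (h : θ ≤ g z')
    rw [hg z' hz'] at h
    rw [hg z hz]
    nlinarith [mul_le_mul_of_nonpos_left hzz hα]

/-- A layer of `u` ReLU nodes multiplies the number of affine pieces by at most `u + 1`. -/
lemma exists_label_relu_layer {u P : ℕ} {c : ℝ → ℕ} (hc : Monotone c) (hP : ∀ z, c z < P)
    (v : ℝ → Fin u → ℝ)
    (hv : ∀ j, ∃ α β : Fin u → ℝ, ∀ z, c z = j → ∀ i, v z i = α i * z + β i) :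
    ∃ c' : ℝ → ℕ, Monotone c' ∧ (∀ z, c' z < P * (u + 1)) ∧
      ∀ j, ∃ α β : Fin u → ℝ, ∀ z, c' z = j → ∀ i, max (v z i) 0 = α i * z + β i := by
  classical
  obtain ⟨c', hc', hP', h⟩ := exists_monotone_label_refinement hc hP (fun i z => 0 ≤ v z i) (by
    intro i j
    obtain ⟨α, β, hab⟩ := hv j
    exact monotoneOn_or_antitoneOn_le_affine (α := α i) (β := β i) 0 fun z hz => hab z hz i)
  refine ⟨c', hc', hP', fun j => ?_⟩
  -- Signs are constant on a nonempty class, so one representative decides which nodes are active; a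
  -- label never attained takes arbitrary coefficients.
  by_cases hj : ∃ z₀, c' z₀ = j
  · obtain ⟨z₀, rfl⟩ := hj
    obtain ⟨α, β, hab⟩ := hv (c z₀)
    refine ⟨fun i => if 0 ≤ v z₀ i then α i else 0, fun i => if 0 ≤ v z₀ i then β i else 0,
      fun z hz i => ?_⟩
    obtain ⟨h1, h2⟩ := h z z₀ hz
    by_cases hs : 0 ≤ v z₀ i
    · simp only [if_pos hs]
      rw [max_eq_left ((h2 i).mpr hs), hab z h1 i]
    · simp only [if_neg hs]
      rw [max_eq_right (not_le.mp fun h' => hs ((h2 i).mp h')).le]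
      ring
  · exact ⟨0, 0, fun z hz => (hj ⟨z, hz⟩).elim⟩

/-- Fibres of a monotone label are order-convex, so labels stand for affine pieces without tracking
breakpoints. The affine part of a layer keeps the pieces; only the activation splits them. -/
lemma HiddenLayers.exists_label {u l : ℕ} (H : HiddenLayers u l) :
    ∃ c : ℝ → ℕ, Monotone c ∧ (∀ z, c z < (u + 1) ^ l) ∧
      ∀ j, ∃ α β : Fin u → ℝ, ∀ z, c z = j → ∀ i, H.eval z i = α i * z + β i := by
  induction H with
  | first w b =>
    obtain ⟨c, hc, hP, h⟩ := exists_label_relu_layer (c := fun _ => 0) (P := 1) monotone_const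
      (fun _ => Nat.one_pos) (fun z i => w i * z + b i) fun _ => ⟨w, b, fun _ _ _ => rfl⟩
    exact ⟨c, hc, by simpa using hP, h⟩
  | next H W b ih =>
    obtain ⟨c, hc, hP, h⟩ := ih
    obtain ⟨c', hc', hP', haff⟩ := exists_label_relu_layer hc hP
      (fun z i => (∑ j, W i j * H.eval z j) + b i) (by
        intro j
        obtain ⟨α, β, hab⟩ := h j
        refine ⟨fun i => ∑ k, W i k * α k, fun i => (∑ k, W i k * β k) + b i, fun z hz i => ?_⟩
        simp only [hab z hz, Finset.sum_mul, mul_add, Finset.sum_add_distrib, mul_assoc, add_assoc])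
    exact ⟨c', hc', by simpa [pow_succ] using hP', haff⟩

/-- The thresholded output of a network is constant on the classes of a monotone labelling with
few labels. -/
lemma ReLUNetwork.exists_label {l u : ℕ} (G : ReLUNetwork l u) (θ : ℝ) :
    ∃ c : ℝ → ℕ, Monotone c ∧ (∀ z, c z < 2 * (u + 1) ^ l) ∧
      ∀ z z', c z = c z' → thresholdLabel θ (G.eval z) = thresholdLabel θ (G.eval z') := by
  obtain ⟨c, hc, hP, h⟩ := G.hidden.exists_label
  -- The threshold is a single predicate, so it costs the factor `1 + 1 = 2`.
  obtain ⟨c', hc', hP', h'⟩ := exists_monotone_label_refinement hc hP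
    (fun (_ : Fin 1) z => θ ≤ G.eval z) (by
      intro i j
      obtain ⟨α, β, hab⟩ := h j
      refine monotoneOn_or_antitoneOn_le_affine (α := ∑ k, G.c k * α k)
        (β := (∑ k, G.c k * β k) + G.d) θ fun z hz => ?_
      simp only [ReLUNetwork.eval, hab z hz, Finset.sum_mul, mul_add, Finset.sum_add_distrib,
        mul_assoc, add_assoc])
  refine ⟨c', hc', fun z => by simpa [mul_comm] using hP' z, fun z z' hz => ?_⟩
  have := (h' z z' hz).2 0
  simp only [thresholdLabel, this]

/-- A classifier which is constant on the classes of a monotone labelling with fewer than `K` labels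
misclassifies many of `n + 1` points with alternating labels. -/
lemma le_two_mul_sum_errors {n K : ℕ} (d : ℕ → ℕ) (e : ℕ → ℕ) (hK : d n < K)
    (h : ∀ i < n, d i + 1 ≤ d (i + 1) + e i + e (i + 1)) :
    n + 1 ≤ K + 2 * ∑ i ∈ Finset.range (n + 1), e i := by
  -- Summing the hypothesis counts every interior error twice and the two end errors once, hence the
  -- correction `e 0 + e j`.
  have key : ∀ j ≤ n, j + e 0 + e j ≤ d j + 2 * ∑ i ∈ Finset.range (j + 1), e i := by
    intro j
    induction j with
    | zero => intro _; simp; omega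
    | succ j ih =>
      intro hj
      have h1 := ih (by omega)
      have h2 := h j (by omega)
      rw [Finset.sum_range_succ]
      omega
  have := key n le_rfl
  omega

lemma one_fourth_le_classificationError {N l u : ℕ} (hl : 1 ≤ l) (hu : 1 ≤ u)
    (hN : (8 * u) ^ l ≤ N) {x : Fin N → I} {y : Fin N → Fin 2} (hx : StrictMono x)
    (hy : ∀ i, y i = if Even (i : ℕ) then 0 else 1) (θ : ℝ) (G : ReLUNetwork l u) :
    1 / 4 ≤ classificationError θ x y (fun z => G.eval (z : ℝ)) := by
  classical
  obtain ⟨c, hc, hP, h⟩ := G.exists_label θ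
  -- Uses `u + 1 ≤ 2 * u` and `4 ≤ 4 ^ l`. The class count is then at most `N / 2`, leaving at least
  -- `N / 4` errors.
  have hbound : 4 * (u + 1) ^ l ≤ N := by
    refine le_trans ?_ hN
    calc 4 * (u + 1) ^ l ≤ 4 ^ l * (2 * u) ^ l := by
          gcongr
          · exact Nat.le_self_pow (by omega) 4
          · omega
      _ = (8 * u) ^ l := by rw [← mul_pow]; ring
  have hNpos : 0 < N := lt_of_lt_of_le (by positivity) hbound
  obtain ⟨n, rfl⟩ : ∃ n, N = n + 1 := ⟨N - 1, by omega⟩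
  let E : Fin (n + 1) → ℕ := fun i => if thresholdLabel θ (G.eval (x i)) ≠ y i then 1 else 0
  let e : ℕ → ℕ := fun i => if hi : i < n + 1 then E ⟨i, hi⟩ else 0
  let d : ℕ → ℕ := fun i => if hi : i < n + 1 then c (x ⟨i, hi⟩) else 0
  have hmain := le_two_mul_sum_errors (n := n) (K := 2 * (u + 1) ^ l) d e
    (by simpa [d] using hP _) (by
      intro i hi
      have hi1 : i < n + 1 := by omega
      have hi2 : i + 1 < n + 1 := by omega
      simp only [d, e, dif_pos hi1, dif_pos hi2]
      have hxx : ((x ⟨i, hi1⟩ : I) : ℝ) ≤ x ⟨i + 1, hi2⟩ :=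
        (hx (Fin.mk_lt_mk.mpr (Nat.lt_succ_self i))).le
      rcases (hc hxx).lt_or_eq with hlt | heq
      · omega
      · have hlab := h _ _ heq
        have hne : y ⟨i, hi1⟩ ≠ y ⟨i + 1, hi2⟩ := by
          rw [hy, hy]
          by_cases hpar : Even i <;> simp [hpar, Nat.even_add_one]
        have : 1 ≤ E ⟨i, hi1⟩ + E ⟨i + 1, hi2⟩ := by
          by_contra hcon
          have h1 : E ⟨i, hi1⟩ = 0 := by omega
          have h2 : E ⟨i + 1, hi2⟩ = 0 := by omega
          simp only [E, ite_eq_right_iff, one_ne_zero, imp_false, not_not] at h1 h2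
          exact hne (by rw [← h1, ← h2, hlab])
        omega)
  have hsum : ∑ i ∈ Finset.range (n + 1), e i = ∑ i, E i := by
    rw [Finset.sum_range]
    exact Finset.sum_congr rfl fun i _ => dif_pos i.2
  rw [hsum] at hmain
  have hE : (((∑ i, E i : ℕ) : ℕ) : ℝ) =
      ∑ i : Fin (n + 1), if thresholdLabel θ (G.eval (x i)) ≠ y i then (1 : ℝ) else 0 := by
    simp [E]
  have h4 : n + 1 ≤ 4 * ∑ i, E i := by omega
  have h4' : ((n + 1 : ℕ) : ℝ) ≤ 4 * ((∑ i, E i : ℕ) : ℝ) := by exact_mod_cast h4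
  rw [hE] at h4'
  unfold classificationError
  have hpos : (0 : ℝ) < ((n + 1 : ℕ) : ℝ) := by positivity
  rw [one_div_mul_eq_div, le_div_iff₀ hpos]
  linarith

/-! ### Oscillations -/

section Oscillation

variable {α β δ : Type*}

/-- `h` alternates between `a` and `b` at `N + 1` increasing points of `[c, d]` (no condition if
`N = 0`). -/
def OscillatesOn [Preorder α] (h : α → β) (a b : β) (c d : α) (N : ℕ) : Prop :=
  ∃ l : List α, l.Pairwise (· < ·) ∧ (∀ u ∈ l, u ∈ Set.Icc c d) ∧ (l.map h).IsChain (· ≠ ·) ∧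
    (∀ v ∈ l.map h, v = a ∨ v = b) ∧ (N ≠ 0 → N + 1 ≤ l.length)

lemma OscillatesOn.zero [Preorder α] (h : α → β) (a b : β) (c d : α) :
    OscillatesOn h a b c d 0 :=
  ⟨[], by simp, by simp, by simp, by simp, by simp⟩

lemma OscillatesOn.mono [Preorder α] {h : α → β} {a b : β} {c d c' d' : α} {N : ℕ}
    (H : OscillatesOn h a b c d N) (hc : c' ≤ c) (hd : d ≤ d') : OscillatesOn h a b c' d' N := by
  obtain ⟨l, h1, h2, h3⟩ := H
  exact ⟨l, h1, fun u hu => Set.Icc_subset_Icc hc hd (h2 u hu), h3⟩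

/-- Oscillations on adjacent intervals add up. -/
lemma OscillatesOn.add [PartialOrder α] {h : α → β} {a b : β} {c d e : α} {N₁ N₂ : ℕ}
    (H₁ : OscillatesOn h a b c d N₁) (H₂ : OscillatesOn h a b d e N₂) (hcd : c ≤ d) (hde : d ≤ e) :
    OscillatesOn h a b c e (N₁ + N₂) := by
  rcases Nat.eq_zero_or_pos N₁ with rfl | hN₁
  · simpa using H₂.mono hcd le_rfl
  rcases Nat.eq_zero_or_pos N₂ with rfl | hN₂
  · simpa using H₁.mono le_rfl hde
  obtain ⟨l₁, hs₁, hI₁, hc₁, hv₁, hl₁⟩ := H₁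
  obtain ⟨l₂, hs₂, hI₂, hc₂, hv₂, hl₂⟩ := H₂
  have hl₁ := hl₁ hN₁.ne'
  have hl₂ := hl₂ hN₂.ne'
  match l₂, hl₂ with
  | y :: t, hl₂ =>
    have hly : ∀ z ∈ l₁, z ≤ y := fun z hz =>
      (hI₁ z hz).2.trans (hI₂ y (by simp)).1
    have hyt : ∀ z ∈ t, y < z := (List.pairwise_cons.mp hs₂).1
    have hmem : ∀ z ∈ l₁ ++ y :: t, z ∈ Set.Icc c e := by
      intro z hz
      rcases List.mem_append.mp hz with hz | hz
      · exact ⟨(hI₁ z hz).1, (hI₁ z hz).2.trans hde⟩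
      · exact ⟨hcd.trans (hI₂ z hz).1, (hI₂ z hz).2⟩
    have hval : ∀ v ∈ (l₁ ++ y :: t).map h, v = a ∨ v = b := by
      intro v hv
      rw [List.map_append, List.mem_append] at hv
      exact hv.elim (hv₁ v) (hv₂ v)
    obtain ⟨l₀, w, rfl⟩ : ∃ l₀ w, l₁ = l₀ ++ [w] := by
      rcases List.eq_nil_or_concat l₁ with h0 | ⟨l₀, w, h0⟩
      · subst h0; simp at hl₁
      · exact ⟨l₀, w, by simpa using h0⟩
    -- At the junction, equal values force one point to be dropped, which still leaves `N₁ + N₂ +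
    -- 1`; otherwise the lists are joined whole.
    by_cases hwy : h w = h y
    · refine ⟨(l₀ ++ [w]) ++ t, ?_, ?_, ?_, ?_, ?_⟩
      · rw [List.pairwise_append]
        exact ⟨hs₁, (List.pairwise_cons.mp hs₂).2, fun z hz z' hz' =>
          (hly z hz).trans_lt (hyt z' hz')⟩
      · intro z hz
        refine hmem z ?_
        simp only [List.mem_append, List.mem_cons] at hz ⊢
        tauto
      · rw [List.map_append, List.isChain_append]
        rw [List.map_cons] at hc₂
        refine ⟨hc₁, hc₂.tail, ?_⟩
        intro p hp r hr
        have hpw : p = h w := by simpa [eq_comm] using hp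
        subst hpw
        rw [hwy]
        exact (List.isChain_cons.mp hc₂).1 r hr
      · intro v hv
        refine hval v ?_
        simp only [List.map_append, List.map_cons, List.mem_append, List.mem_cons] at hv ⊢
        tauto
      · intro _
        simp only [List.length_append, List.length_cons] at hl₁ hl₂ ⊢
        omega
    · refine ⟨(l₀ ++ [w]) ++ y :: t, ?_, hmem, ?_, hval, ?_⟩
      · rw [List.pairwise_append]
        refine ⟨hs₁, hs₂, fun z hz z' hz' => ?_⟩
        have hzy : z < y := by
          have hw : w < y := lt_of_le_of_ne (hly w (by simp)) (fun h' => hwy (by rw [h']))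
          rcases List.mem_append.mp hz with hz0 | hz0
          · exact ((List.pairwise_append.mp hs₁).2.2 z hz0 w (by simp)).trans hw
          · rw [List.mem_singleton.mp hz0]; exact hw
        rcases List.mem_cons.mp hz' with rfl | hz'
        · exact hzy
        · exact hzy.trans (hyt z' hz')
      · rw [List.map_append, List.isChain_append]
        refine ⟨hc₁, hc₂, ?_⟩
        intro p hp r hr
        have hpw : p = h w := by simpa [eq_comm] using hp
        have hrw : r = h y := by simpa [eq_comm] using hr
        rw [hpw, hrw]
        exact hwy
      · intro _
        simp only [List.length_append, List.length_cons] at hl₁ hl₂ ⊢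
        omega

/-- Increasing points between `g c` and `g d` have increasing preimages in `[c, d]`. -/
lemma exists_increasing_preimages [ConditionallyCompleteLinearOrder α] [TopologicalSpace α]
    [OrderTopology α] [DenselyOrdered α] [LinearOrder δ] [TopologicalSpace δ]
    [OrderClosedTopology δ] {g : α → δ} (hg : Continuous g) {d : α} (l : List δ) :
    ∀ c, c ≤ d → l.Pairwise (· < ·) → (∀ u ∈ l, u ∈ Set.Icc (g c) (g d)) →
      ∃ l' : List α, l'.map g = l ∧ l'.Pairwise (· < ·) ∧ ∀ u ∈ l', u ∈ Set.Icc c d := by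
  induction l with
  | nil => exact fun _ _ _ _ => ⟨[], by simp, by simp, by simp⟩
  | cons v t ih =>
    intro c hcd hs hI
    -- After a preimage `w` of the smallest value is chosen, the other values lie between `g w` and
    -- `g d`, so the search continues in `[w, d]`.
    obtain ⟨w, hw, rfl⟩ := intermediate_value_Icc hcd hg.continuousOn (hI v (by simp))
    rw [List.pairwise_cons] at hs
    obtain ⟨l', rfl, hs', hI'⟩ := ih w hw.2 hs.2 fun u hu =>
      ⟨(hs.1 u hu).le, (hI u (by simp [hu])).2⟩
    refine ⟨w :: l', rfl, List.pairwise_cons.mpr ⟨fun z hz => ?_, hs'⟩, fun z hz => ?_⟩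
    · refine lt_of_le_of_ne (hI' z hz).1 ?_
      rintro rfl
      exact lt_irrefl _ (hs.1 _ (List.mem_map_of_mem hz))
    · rcases List.mem_cons.mp hz with rfl | hz
      · exact hw
      · exact ⟨hw.1.trans (hI' z hz).1, (hI' z hz).2⟩

/-- If the image of `[c, d]` covers `[c', d']`, oscillations of `h` on `[c', d']` lift to
oscillations of `h ∘ g` on `[c, d]`. -/
lemma OscillatesOn.comp [ConditionallyCompleteLinearOrder α] [TopologicalSpace α]
    [OrderTopology α] [DenselyOrdered α] {g : α → α} (hg : Continuous g) {h : α → β} {a b : β}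
    {c d : α} {N : ℕ} (hcd : c ≤ d)
    (H : OscillatesOn h a b (min (g c) (g d)) (max (g c) (g d)) N) :
    OscillatesOn (h ∘ g) a b c d N := by
  obtain ⟨l, hs, hI, hc, hv, hl⟩ := H
  rcases le_total (g c) (g d) with hle | hle
  · rw [min_eq_left hle, max_eq_right hle] at hI
    obtain ⟨l', rfl, hs', hI'⟩ := exists_increasing_preimages hg l c hcd hs hI
    exact ⟨l', hs', hI', by simpa using hc, by simpa using hv, by simpa using hl⟩
  · rw [min_eq_right hle, max_eq_left hle] at hI
    -- When `g d ≤ g c`, the order of the target is reversed and the list is read backwards.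
    obtain ⟨l', hl', hs', hI'⟩ := exists_increasing_preimages (δ := αᵒᵈ)
      (g := fun z => OrderDual.toDual (g z)) (continuous_toDual.comp hg) (d := d)
      (l.reverse.map OrderDual.toDual) c hcd
      (by
        rw [List.pairwise_map, List.pairwise_reverse]
        exact hs)
      (by
        intro u hu
        obtain ⟨v, hv, rfl⟩ := List.mem_map.mp hu
        have := hI v (List.mem_reverse.mp hv)
        exact ⟨this.2, this.1⟩)
    have hmap : l'.map g = l.reverse := by
      have := congrArg (List.map (OrderDual.ofDual : αᵒᵈ → α)) hl'
      simpa [List.map_map, Function.comp_def] using this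
    have hmap2 : l'.map (h ∘ g) = (l.map h).reverse := by
      rw [← List.map_map, hmap, List.map_reverse]
    refine ⟨l', hs', hI', ?_, ?_, ?_⟩
    · rw [hmap2, List.isChain_reverse]
      exact hc.imp fun _ _ hne => hne.symm
    · intro v hv'
      rw [hmap2, List.mem_reverse] at hv'
      exact hv v hv'
    · have : l'.length = l.length := by
        rw [← List.length_map (f := g), hmap, List.length_reverse]
      rwa [this]

/-- `N` oscillations contain `N` alternating points starting with the value `a`. -/
lemma OscillatesOn.exists_strictMono [Preorder α] {h : α → β} {a b : β} {c d : α} {N : ℕ}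
    (hN : N ≠ 0) (H : OscillatesOn h a b c d N) :
    ∃ x : Fin N → α, StrictMono x ∧ ∀ i, h (x i) = if Even (i : ℕ) then a else b := by
  obtain ⟨l, hs, -, hc, hv, hl⟩ := H
  have hl := hl hN
  obtain ⟨l', hs', hc', hv', hl', h0⟩ : ∃ l' : List α, l'.Pairwise (· < ·) ∧
      (l'.map h).IsChain (· ≠ ·) ∧ (∀ v ∈ l'.map h, v = a ∨ v = b) ∧ N ≤ l'.length ∧
      ∀ h0 : 0 < l'.length, h l'[0] = a := by
    -- A first point with value `b` is discarded; this is where one of the `N + 1` points may be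
    -- lost.
    match l, hl with
    | y :: t, hl =>
      by_cases hy : h y = a
      · exact ⟨y :: t, hs, hc, hv, by omega, fun _ => hy⟩
      · have hyb : h y = b := (hv (h y) (by simp)).resolve_left hy
        refine ⟨t, (List.pairwise_cons.mp hs).2, hc.tail,
          fun v hvt => hv v (by simp only [List.map_cons, List.mem_cons]; exact Or.inr hvt),
          by simpa using hl, fun h0 => ?_⟩
        refine (hv (h t[0]) (List.mem_map_of_mem (by simp))).resolve_right fun hb => ?_
        rw [List.isChain_iff_getElem] at hc
        have := hc 0 (by simpa using h0)
        simp [hyb, hb] at this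
  have hval : ∀ (i : ℕ) (hi : i < l'.length), h l'[i] = if Even i then a else b := by
    intro i
    induction i with
    | zero => intro hi; simpa using h0 hi
    | succ i ih =>
      intro hi
      have h1 := ih (by omega)
      rw [List.isChain_iff_getElem] at hc'
      have h2 := hc' i (by simpa using hi)
      have h3 := hv' (h l'[i + 1]) (List.mem_map_of_mem (List.getElem_mem hi))
      simp only [List.getElem_map] at h2
      rw [h1] at h2
      by_cases hpar : Even i
      · simp only [hpar, if_true, Nat.even_add_one, not_true_eq_false, if_false] at h2 ⊢
        exact h3.resolve_left fun h' => h2 h'.symm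
      · simp only [hpar, if_false, Nat.even_add_one, not_false_eq_true, if_true] at h2 ⊢
        exact h3.resolve_right fun h' => h2 h'.symm
  refine ⟨fun i => l'[(i : ℕ)]'(i.2.trans_le hl'), ?_, fun i => hval _ _⟩
  intro i j hij
  exact List.pairwise_iff_getElem.mp hs' _ _ _ _ hij

end Oscillation

/-! ### Covering relations of a cycle -/

section Covering

variable {q : ℕ}

/-- A discrete intermediate value theorem. Applied to "the image lies right of `v`", it finds a
basic interval covering `v`. -/
lemma exists_adjacent_change {Q : Fin (q + 1) → Prop} {s t : Fin (q + 1)} (hst : s ≤ t)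
    (h : ¬ (Q s ↔ Q t)) :
    ∃ w : Fin q, s ≤ w.castSucc ∧ w.succ ≤ t ∧ ¬ (Q w.castSucc ↔ Q w.succ) := by
  by_contra! hcon
  have key : ∀ r : Fin (q + 1), s ≤ r → r ≤ t → (Q s ↔ Q r) := by
    intro r
    induction r using Fin.induction with
    | zero =>
      intro h0 _
      rw [Fin.le_zero_iff.mp h0]
    | succ w ih =>
      intro h1 h2
      rcases h1.lt_or_eq with h1 | rfl
      · have h3 : s ≤ w.castSucc := Fin.le_castSucc_iff.mpr h1
        exact (ih h3 (w.castSucc_lt_succ.le.trans h2)).trans (hcon w h3 h2)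
      · rfl
  exact h (key t hst le_rfl)

/-- The image of the `w`-th basic interval of a cycle `τ` covers the `v`-th one: the images of the
endpoints of the former lie on different sides of the latter. -/
def Covers (τ : Fin (q + 1) → Fin (q + 1)) (w v : Fin q) : Prop :=
  ¬ (v.castSucc < τ w.castSucc ↔ v.castSucc < τ w.succ)

open Classical in
/-- The adjacency matrix of the covering relation. -/
noncomputable def coverMatrix (τ : Fin (q + 1) → Fin (q + 1)) : Matrix (Fin q) (Fin q) ℕ :=
  Matrix.of fun w v => if Covers τ w v then 1 else 0

lemma coverMatrix_of_covers {τ : Fin (q + 1) → Fin (q + 1)} {w v : Fin q} (h : Covers τ w v) :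
    coverMatrix τ w v = 1 := by
  simp [coverMatrix, h]

lemma injective_of_transitive {ι : Type*} [Finite ι] {τ : ι → ι}
    (hτ : ∀ i j, ∃ n, τ^[n] i = j) : Function.Injective τ := by
  refine Finite.injective_iff_surjective.mpr fun j => ?_
  obtain ⟨n, hn⟩ := hτ (τ j) j
  exact ⟨τ^[n] j, by rwa [← Function.iterate_succ_apply' τ, Function.iterate_succ_apply]⟩

/-- A basic interval whose endpoints move past each other. -/
lemma exists_swapped_interval {τ : Fin (q + 1) → Fin (q + 1)} (hq : 0 < q)
    (hτ : ∀ i j, ∃ n, τ^[n] i = j) :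
    ∃ J : Fin q, J.succ ≤ τ J.castSucc ∧ τ J.succ ≤ J.castSucc := by
  classical
  have hfix : ∀ i, τ i ≠ i := by
    intro i hi
    have hall : ∀ j, i = j := fun j => by
      obtain ⟨n, hn⟩ := hτ i j
      rwa [Function.iterate_fixed hi] at hn
    have h0 := hall 0
    have h1 := hall (Fin.last q)
    rw [h0] at h1
    have := congrArg Fin.val h1
    simp at this
    omega
  -- Without a swap, moving right passes from each point to the next, since no point is fixed; but
  -- the last point cannot move right.
  by_contra! hcon
  have hall : ∀ i : Fin (q + 1), i < τ i := by
    intro i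
    induction i using Fin.induction with
    | zero => exact Fin.pos_iff_ne_zero.mpr (hfix 0)
    | succ w ih =>
      have h1 := hcon w (Fin.castSucc_lt_iff_succ_le.mp ih)
      exact lt_of_le_of_ne (Fin.castSucc_lt_iff_succ_le.mp h1) (hfix _).symm
  exact absurd (hall (Fin.last q)) (not_lt.mpr (Fin.le_last _))

lemma covers_of_swapped {τ : Fin (q + 1) → Fin (q + 1)} {J : Fin q}
    (h₁ : J.succ ≤ τ J.castSucc) (h₂ : τ J.succ ≤ J.castSucc) : Covers τ J J := by
  have h3 : J.castSucc < τ J.castSucc := J.castSucc_lt_succ.trans_le h₁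
  have h4 : ¬ J.castSucc < τ J.succ := not_lt.mpr h₂
  unfold Covers
  tauto

/-- In a cycle of odd length, the swapped basic interval is covered by another one. -/
lemma exists_covers_ne {τ : Fin (q + 1) → Fin (q + 1)} (hq : Even q)
    (hτ : Function.Injective τ) {J : Fin q}
    (h₁ : J.succ ≤ τ J.castSucc) (h₂ : τ J.succ ≤ J.castSucc) : ∃ v, v ≠ J ∧ Covers τ v J := by
  classical
  by_contra! hcon
  have h3 : J.castSucc < τ J.castSucc := J.castSucc_lt_succ.trans_le h₁
  have h4 : ¬ J.castSucc < τ J.succ := not_lt.mpr h₂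
  -- If `J` alone covers `J`, the image changes side only across `J`, so `τ` exchanges the two
  -- sides. Injectivity makes them equal in size, contradicting that `q + 1` is odd.
  have hL : ∀ i ≤ J.castSucc, J.castSucc < τ i := by
    intro i hi
    by_contra hni
    obtain ⟨w, -, hw, hc⟩ := exists_adjacent_change (Q := fun i => J.castSucc < τ i) hi (by tauto)
    refine hcon w ?_ hc
    rintro rfl
    exact absurd hw (not_le.mpr w.castSucc_lt_succ)
  have hR : ∀ i, J.castSucc < i → τ i ≤ J.castSucc := by
    intro i hi
    by_contra hni
    obtain ⟨w, hw, -, hc⟩ := exists_adjacent_change (Q := fun i => J.castSucc < τ i)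
      (Fin.castSucc_lt_iff_succ_le.mp hi) (by have := not_le.mp hni; tauto)
    refine hcon w ?_ hc
    rintro rfl
    exact absurd hw (not_le.mpr w.castSucc_lt_succ)
  have c1 : (Finset.Iic J.castSucc).card ≤ (Finset.Ioi J.castSucc).card :=
    Finset.card_le_card_of_injOn τ (fun i hi => by simpa using hL i (by simpa using hi))
      hτ.injOn
  have c2 : (Finset.Ioi J.castSucc).card ≤ (Finset.Iic J.castSucc).card :=
    Finset.card_le_card_of_injOn τ (fun i hi => by simpa using hR i (by simpa using hi))
      hτ.injOn
  rw [Fin.card_Iic, Fin.card_Ioi] at c1 c2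
  simp only [Fin.val_castSucc] at c1 c2
  obtain ⟨r, hr⟩ := hq
  have := J.2
  omega

lemma coverMatrix_pow_succ_pos {τ : Fin (q + 1) → Fin (q + 1)} {k : ℕ} {i w v : Fin q}
    (h : 0 < (coverMatrix τ ^ k) i w) (hc : Covers τ w v) :
    0 < (coverMatrix τ ^ (k + 1)) i v := by
  rw [pow_succ, Matrix.mul_apply]
  refine Finset.sum_pos' (fun _ _ => Nat.zero_le _) ⟨w, Finset.mem_univ _, ?_⟩
  rw [coverMatrix_of_covers hc]
  simpa using h

lemma coverMatrix_pow_succ_pos' {τ : Fin (q + 1) → Fin (q + 1)} {k : ℕ} {i w v : Fin q}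
    (hc : Covers τ i w) (h : 0 < (coverMatrix τ ^ k) w v) :
    0 < (coverMatrix τ ^ (k + 1)) i v := by
  rw [pow_succ', Matrix.mul_apply]
  refine Finset.sum_pos' (fun _ _ => Nat.zero_le _) ⟨w, Finset.mem_univ _, ?_⟩
  rw [coverMatrix_of_covers hc]
  simpa using h

/-- The basic intervals reached from the swapped one in `k` steps contain a block of at least
`min (k + 1) q` consecutive ones. -/
lemma exists_reachable_block {τ : Fin (q + 1) → Fin (q + 1)} (hτ : ∀ i j, ∃ n, τ^[n] i = j)
    {J : Fin q} (h₁ : J.succ ≤ τ J.castSucc) (h₂ : τ J.succ ≤ J.castSucc) (k : ℕ) :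
    ∃ lo hi : Fin (q + 1), lo ≤ J.castSucc ∧ J.succ ≤ hi ∧
      (∀ v : Fin q, lo ≤ v.castSucc → v.succ ≤ hi → 0 < (coverMatrix τ ^ k) J v) ∧
      min (k + 1) q + lo.val ≤ hi.val := by
  have hJ := covers_of_swapped h₁ h₂
  induction k with
  | zero =>
    refine ⟨J.castSucc, J.succ, le_rfl, le_rfl, fun v hv1 hv2 => ?_, ?_⟩
    · have : v = J := le_antisymm (by simpa using hv2) (by simpa using hv1)
      simp [this]
    · simp only [Fin.val_castSucc, Fin.val_succ]; omega
  | succ k ih =>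
    obtain ⟨lo, hi, hlo, hhi, hpos, hlen⟩ := ih
    have hlohi : lo ≤ hi := hlo.trans (J.castSucc_lt_succ.le.trans hhi)
    -- An invariant block is everything by transitivity. Otherwise some image `τ t` escapes, and the
    -- block is stretched to it; old intervals stay reachable by waiting at `J` for one step.
    by_cases hinv : ∀ t, lo ≤ t → t ≤ hi → lo ≤ τ t ∧ τ t ≤ hi
    · have hiter : ∀ n, lo ≤ τ^[n] lo ∧ τ^[n] lo ≤ hi := by
        intro n
        induction n with
        | zero => exact ⟨le_rfl, hlohi⟩
        | succ n ihn =>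
          rw [Function.iterate_succ_apply']
          exact hinv _ ihn.1 ihn.2
      have hall : ∀ j, lo ≤ j ∧ j ≤ hi := fun j => by
        obtain ⟨n, rfl⟩ := hτ lo j
        exact hiter n
      refine ⟨lo, hi, hlo, hhi, fun v hv1 hv2 => coverMatrix_pow_succ_pos' hJ (hpos v hv1 hv2), ?_⟩
      have a1 : lo.val ≤ 0 := (hall 0).1
      have a2 : q ≤ hi.val := (hall (Fin.last q)).2
      omega
    · push Not at hinv
      obtain ⟨t, ht1, ht2, ht3⟩ := hinv
      have hreach : ∀ s : Fin (q + 1), lo ≤ s → s ≤ hi → ∀ v : Fin q,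
          ¬ (v.castSucc < τ s ↔ v.castSucc < τ t) → 0 < (coverMatrix τ ^ (k + 1)) J v := by
        intro s hs1 hs2 v hv
        rcases le_total s t with hst | hst
        · obtain ⟨w, hw1, hw2, hw3⟩ :=
            exists_adjacent_change (Q := fun i => v.castSucc < τ i) hst hv
          exact coverMatrix_pow_succ_pos (hpos w (hs1.trans hw1) (hw2.trans ht2)) hw3
        · obtain ⟨w, hw1, hw2, hw3⟩ :=
            exists_adjacent_change (Q := fun i => v.castSucc < τ i) hst (fun h => hv h.symm)
          exact coverMatrix_pow_succ_pos (hpos w (ht1.trans hw1) (hw2.trans hs2)) hw3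
      by_cases htlo : lo ≤ τ t
      · have hgt := ht3 htlo
        refine ⟨lo, τ t, hlo, hhi.trans hgt.le, fun v hv1 hv2 => ?_, ?_⟩
        · by_cases hv : v.succ ≤ hi
          · exact coverMatrix_pow_succ_pos' hJ (hpos v hv1 hv)
          -- The endpoint of `J` whose image lies on the far side of `v` from `τ t` is used; the
          -- left-hand case uses the other endpoint.
          · refine hreach J.succ (hlo.trans J.castSucc_lt_succ.le) hhi v ?_
            have hv' : hi ≤ v.castSucc := Fin.le_castSucc_iff.mpr (not_le.mp hv)
            have b1 : ¬ v.castSucc < τ J.succ :=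
              not_lt.mpr (h₂.trans (J.castSucc_lt_succ.le.trans (hhi.trans hv')))
            have b2 : v.castSucc < τ t := Fin.castSucc_lt_iff_succ_le.mpr hv2
            tauto
        · have : hi.val < (τ t).val := hgt
          omega
      · have hlt := not_le.mp htlo
        refine ⟨τ t, hi, hlt.le.trans hlo, hhi, fun v hv1 hv2 => ?_, ?_⟩
        · by_cases hv : lo ≤ v.castSucc
          · exact coverMatrix_pow_succ_pos' hJ (hpos v hv hv2)
          · refine hreach J.castSucc hlo (J.castSucc_lt_succ.le.trans hhi) v ?_
            have b1 : v.castSucc < τ J.castSucc :=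
              (not_le.mp hv).trans_le (hlo.trans (J.castSucc_lt_succ.le.trans h₁))
            have b2 : ¬ v.castSucc < τ t := not_lt.mpr hv1
            tauto
        · have : (τ t).val < lo.val := hlt
          omega

lemma coverMatrix_pow_pos {τ : Fin (q + 1) → Fin (q + 1)} (hτ : ∀ i j, ∃ n, τ^[n] i = j)
    {J : Fin q} (h₁ : J.succ ≤ τ J.castSucc) (h₂ : τ J.succ ≤ J.castSucc) (v : Fin q) :
    0 < (coverMatrix τ ^ (q - 1)) J v := by
  obtain ⟨lo, hi, -, -, hpos, hlen⟩ := exists_reachable_block hτ h₁ h₂ (q - 1)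
  have hv := v.2
  have h3 := hi.2
  refine hpos v (Fin.le_def.mpr ?_) (Fin.le_def.mpr ?_)
  · simp only [Fin.val_castSucc]; omega
  · simp only [Fin.val_succ]; omega

/-- The number of covering paths of length `k` which end at the swapped interval grows at least
like `ρ ^ k`, where `ρ` is the root of `ρ ^ q = ρ ^ (q - 1) + 1`. -/
lemma pow_le_sum_coverMatrix_pow {τ : Fin (q + 1) → Fin (q + 1)} (hq : Even q)
    (hτ : ∀ i j, ∃ n, τ^[n] i = j)
    {J : Fin q} (h₁ : J.succ ≤ τ J.castSucc) (h₂ : τ J.succ ≤ J.castSucc)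
    {ρ : ℝ} (hρ1 : 1 < ρ) (hρ : ρ ^ q = ρ ^ (q - 1) + 1) (k : ℕ) :
    ρ ^ k ≤ ((∑ i, (coverMatrix τ ^ k) i J : ℕ) : ℝ) := by
  have hq0 : 0 < q := J.pos
  obtain ⟨v, hvJ, hv⟩ := exists_covers_ne hq (injective_of_transitive hτ) h₁ h₂
  have hJ := covers_of_swapped h₁ h₂
  have hpos := coverMatrix_pow_pos hτ h₁ h₂ v
  have hstep : ∀ k, (∑ i, (coverMatrix τ ^ k) i J) + ∑ i, (coverMatrix τ ^ k) i v ≤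
      ∑ i, (coverMatrix τ ^ (k + 1)) i J := by
    intro k
    rw [← Finset.sum_add_distrib]
    refine Finset.sum_le_sum fun i _ => ?_
    rw [pow_succ, Matrix.mul_apply]
    have := Finset.sum_le_sum_of_subset (f := fun j => (coverMatrix τ ^ k) i j * coverMatrix τ j J)
      (Finset.subset_univ {J, v})
    rw [Finset.sum_pair hvJ.symm, coverMatrix_of_covers hJ, coverMatrix_of_covers hv] at this
    simpa using this
  have hlong : ∀ k, ∑ i, (coverMatrix τ ^ k) i J ≤ ∑ i, (coverMatrix τ ^ (k + (q - 1))) i v := by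
    intro k
    refine Finset.sum_le_sum fun i _ => ?_
    rw [pow_add, Matrix.mul_apply]
    refine le_trans ?_ (Finset.single_le_sum
      (f := fun j => (coverMatrix τ ^ k) i j * (coverMatrix τ ^ (q - 1)) j v)
      (fun _ _ => Nat.zero_le _) (Finset.mem_univ J))
    exact Nat.le_mul_of_pos_right _ hpos
  -- The last `k` steps of a path of length `q - 1` from `J` to `v` form a path into `v`.
  have hshort : ∀ k ≤ q - 1, 1 ≤ ∑ i, (coverMatrix τ ^ k) i v := by
    intro k hk
    by_contra hcon
    have hz : ∀ i, (coverMatrix τ ^ k) i v = 0 := by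
      have : ∑ i, (coverMatrix τ ^ k) i v = 0 := by omega
      simpa using this
    have : (coverMatrix τ ^ (q - 1)) J v = 0 := by
      rw [show q - 1 = (q - 1 - k) + k by omega, pow_add, Matrix.mul_apply]
      simp [hz]
    omega
  have hroot : ρ ^ (q - 1) * (ρ - 1) = 1 := by
    have : ρ ^ q = ρ ^ (q - 1) * ρ := by rw [← pow_succ]; congr 1; omega
    rw [this] at hρ
    linarith
  induction k using Nat.strong_induction_on with
  | _ k ih =>
    rcases Nat.eq_zero_or_pos k with rfl | hk
    · simp [Matrix.one_apply]
    · obtain ⟨k, rfl⟩ : ∃ j, k = j + 1 := ⟨k - 1, by omega⟩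
      have hs : ((∑ i, (coverMatrix τ ^ k) i J : ℕ) : ℝ) +
          ((∑ i, (coverMatrix τ ^ k) i v : ℕ) : ℝ) ≤
          ((∑ i, (coverMatrix τ ^ (k + 1)) i J : ℕ) : ℝ) := by exact_mod_cast hstep k
      have ihk := ih k (by omega)
      have hpw : ρ ^ (k + 1) = ρ ^ k + ρ ^ k * (ρ - 1) := by ring
      suffices ρ ^ k * (ρ - 1) ≤ ((∑ i, (coverMatrix τ ^ k) i v : ℕ) : ℝ) by linarith
      -- The increment needed is `ρ ^ k * (ρ - 1)`: at most `1` for `k ≤ q - 1` by `hroot`, and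
      -- equal to `ρ ^ (k - (q - 1))` afterwards, where `hlong` supplies it.
      rcases le_total k (q - 1) with hkq | hkq
      · have h1 : (1 : ℝ) ≤ ((∑ i, (coverMatrix τ ^ k) i v : ℕ) : ℝ) := by
          exact_mod_cast hshort k hkq
        exact (mul_le_mul_of_nonneg_right (pow_le_pow_right₀ hρ1.le hkq)
          (sub_nonneg.mpr hρ1.le)).trans (hroot.le.trans h1)
      · obtain ⟨j, rfl⟩ : ∃ j, k = j + (q - 1) := ⟨k - (q - 1), by omega⟩
        have h1 : ((∑ i, (coverMatrix τ ^ j) i J : ℕ) : ℝ) ≤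
            ((∑ i, (coverMatrix τ ^ (j + (q - 1))) i v : ℕ) : ℝ) := by exact_mod_cast hlong j
        have h2 := ih j (by omega)
        calc ρ ^ (j + (q - 1)) * (ρ - 1) = ρ ^ j * (ρ ^ (q - 1) * (ρ - 1)) := by ring
          _ = ρ ^ j := by rw [hroot, mul_one]
          _ ≤ _ := h2.trans h1

end Covering

/-! ### Oscillations of the iterates of a map with a cycle -/

/-- The points of a cycle in increasing order, and the action of the map on their indices. -/
lemma exists_sorted_cycle {α : Type*} [LinearOrder α] {g : α → α} {x₀ : α} {q : ℕ}
    (h : Function.minimalPeriod g x₀ = q + 1) :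
    ∃ (x : Fin (q + 1) → α) (τ : Fin (q + 1) → Fin (q + 1)), StrictMono x ∧
      (∀ i, g (x i) = x (τ i)) ∧ ∀ i j, ∃ n, τ^[n] i = j := by
  classical
  let s : Finset α := (Finset.range (q + 1)).image (fun n => g^[n] x₀)
  have hs : s.card = q + 1 := by
    rw [Finset.card_image_of_injOn, Finset.card_range]
    have := Function.iterate_injOn_Iio_minimalPeriod (f := g) (x := x₀)
    rw [h] at this
    simpa using this
  have hmem : ∀ n, g^[n] x₀ ∈ s := fun n => by
    rw [← Function.iterate_mod_minimalPeriod_eq, h]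
    exact Finset.mem_image.mpr ⟨n % (q + 1), by simpa using Nat.mod_lt n (Nat.succ_pos q), rfl⟩
  let x := s.orderEmbOfFin hs
  have hx : ∀ z ∈ s, ∃ i, x i = z := fun z hz => by
    have : z ∈ Set.range x := by rw [Finset.range_orderEmbOfFin]; exact hz
    exact this
  have hx' : ∀ i, ∃ n, n < q + 1 ∧ g^[n] x₀ = x i := fun i => by
    obtain ⟨n, hn, hn'⟩ := Finset.mem_image.mp (Finset.orderEmbOfFin_mem s hs i)
    exact ⟨n, by simpa using hn, hn'⟩
  have hτ : ∀ i, ∃ j, x j = g (x i) := fun i => by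
    obtain ⟨n, -, hn⟩ := hx' i
    refine hx _ ?_
    rw [← hn, ← Function.iterate_succ_apply' g]
    exact hmem _
  choose τ hτ using hτ
  have hiter : ∀ n i, x (τ^[n] i) = g^[n] (x i) := by
    intro n
    induction n with
    | zero => intro i; rfl
    | succ n ih => intro i; rw [Function.iterate_succ_apply', hτ, ih, Function.iterate_succ_apply']
  refine ⟨x, τ, x.strictMono, fun i => (hτ i).symm, fun i j => ?_⟩
  obtain ⟨a, ha, hai⟩ := hx' i
  obtain ⟨b, -, hbj⟩ := hx' j
  -- Complete the turn back to `x₀`, then take `b` more steps.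
  refine ⟨b + (q + 1 - a), x.injective ?_⟩
  rw [hiter, ← hai, ← hbj, ← Function.iterate_add_apply,
    show b + (q + 1 - a) + a = b + (q + 1) by omega, Function.iterate_add_apply, ← h,
    Function.iterate_minimalPeriod]

lemma OscillatesOn.sum {α β : Type*} [PartialOrder α] {q : ℕ} {x : Fin (q + 1) → α}
    (hx : StrictMono x) {h : α → β} {a b : β} {N : Fin q → ℕ}
    (H : ∀ v : Fin q, OscillatesOn h a b (x v.castSucc) (x v.succ) (N v)) (s t : Fin (q + 1))
    (hst : s ≤ t) :
    OscillatesOn h a b (x s) (x t) (∑ v : Fin q with s ≤ v.castSucc ∧ v.succ ≤ t, N v) := by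
  induction t using Fin.induction with
  | zero =>
    rw [Finset.filter_false_of_mem, Finset.sum_empty]
    · exact OscillatesOn.zero _ _ _ _ _
    · rintro v - ⟨-, hv⟩
      exact absurd hv (not_le.mpr v.succ_pos)
  | succ w ih =>
    rcases hst.lt_or_eq with hlt | rfl
    · have hs : s ≤ w.castSucc := Fin.le_castSucc_iff.mpr hlt
      have hset : ({v : Fin q | s ≤ v.castSucc ∧ v.succ ≤ w.succ} : Finset (Fin q)) =
          insert w ({v : Fin q | s ≤ v.castSucc ∧ v.succ ≤ w.castSucc} : Finset (Fin q)) := by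
        ext v
        simp only [Finset.mem_filter, Finset.mem_univ, true_and, Finset.mem_insert,
          Fin.succ_le_succ_iff, Fin.succ_le_castSucc_iff]
        constructor
        · rintro ⟨h1, h2⟩
          rcases h2.eq_or_lt with h2 | h2
          · exact Or.inl h2
          · exact Or.inr ⟨h1, h2⟩
        · rintro (rfl | ⟨h1, h2⟩)
          · exact ⟨hs, le_rfl⟩
          · exact ⟨h1, h2.le⟩
      rw [hset, Finset.sum_insert (by simp), add_comm]
      exact (ih hs).add (H w) (hx.monotone hs) (hx w.castSucc_lt_succ).le
    · rw [Finset.filter_false_of_mem, Finset.sum_empty]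
      · exact OscillatesOn.zero _ _ _ _ _
      · rintro v - ⟨h1, h2⟩
        exact absurd (h2.trans h1) (not_le.mpr v.castSucc_lt_succ)

/-- Matches covering with the index set in `OscillatesOn.sum`, so that the sum there becomes a
matrix product entry. -/
lemma covers_iff {q : ℕ} {τ : Fin (q + 1) → Fin (q + 1)} {w v : Fin q} :
    Covers τ w v ↔ min (τ w.castSucc) (τ w.succ) ≤ v.castSucc ∧
      v.succ ≤ max (τ w.castSucc) (τ w.succ) := by
  unfold Covers
  rw [min_le_iff, le_max_iff, ← Fin.castSucc_lt_iff_succ_le, ← Fin.castSucc_lt_iff_succ_le,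
    ← not_lt, ← not_lt]
  tauto

section Iterates

variable {α : Type*} [ConditionallyCompleteLinearOrder α] [TopologicalSpace α] [OrderTopology α]
  [DenselyOrdered α] {g : α → α} {q : ℕ} {x : Fin (q + 1) → α} {τ : Fin (q + 1) → Fin (q + 1)}

/-- Mirrors `A ^ (k + 1) = A * A ^ k`: one application of `g` spreads interval `i` over all
intervals it covers, and the oscillations of `g^[k]` there add up and lift back. -/
lemma oscillatesOn_iterate_basic (hg : Continuous g) (hx : StrictMono x)
    (hτ : ∀ i, g (x i) = x (τ i)) (J : Fin q) (k : ℕ) (i : Fin q) :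
    OscillatesOn g^[k] (x J.castSucc) (x J.succ) (x i.castSucc) (x i.succ)
      ((coverMatrix τ ^ k) i J) := by
  classical
  induction k generalizing i with
  | zero =>
    by_cases hi : i = J
    · subst hi
      have hlt := hx i.castSucc_lt_succ
      exact ⟨[x i.castSucc, x i.succ], by simpa using hlt, by simp [hlt.le],
        by simpa using hlt.ne, by simp, by simp⟩
    · rw [pow_zero, Matrix.one_apply_ne hi]
      exact OscillatesOn.zero _ _ _ _ _
  | succ k ih =>
    rw [Function.iterate_succ]
    refine OscillatesOn.comp hg (hx i.castSucc_lt_succ).le ?_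
    rw [hτ, hτ, ← hx.monotone.map_min, ← hx.monotone.map_max]
    have hsum : (coverMatrix τ ^ (k + 1)) i J = ∑ v : Fin q with
        min (τ i.castSucc) (τ i.succ) ≤ v.castSucc ∧ v.succ ≤ max (τ i.castSucc) (τ i.succ),
        (coverMatrix τ ^ k) v J := by
      rw [pow_succ', Matrix.mul_apply, Finset.sum_filter]
      refine Finset.sum_congr rfl fun v _ => ?_
      simp only [← covers_iff]
      simp [coverMatrix]
    rw [hsum]
    exact OscillatesOn.sum hx ih _ _ min_le_max

lemma oscillatesOn_iterate (hg : Continuous g) (hx : StrictMono x)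
    (hτ : ∀ i, g (x i) = x (τ i)) (J : Fin q) (k : ℕ) :
    OscillatesOn g^[k] (x J.castSucc) (x J.succ) (x 0) (x (Fin.last q))
      (∑ i, (coverMatrix τ ^ k) i J) := by
  have := OscillatesOn.sum hx (oscillatesOn_iterate_basic hg hx hτ J k) 0 (Fin.last q)
    (Fin.zero_le _)
  rwa [Finset.filter_true_of_mem fun v _ => ⟨Fin.zero_le _, Fin.le_last _⟩] at this

/-- Iterates of a continuous map with a cycle of odd period `q + 1 > 1` oscillate exponentially
often between two fixed points of the cycle. -/
lemma exists_alternating_points_iterate (hg : Continuous g) (hq : Even q) (hq0 : 0 < q) {x₀ : α}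
    (h : Function.minimalPeriod g x₀ = q + 1) {ρ : ℝ} (hρ1 : 1 < ρ)
    (hρ : ρ ^ q = ρ ^ (q - 1) + 1) :
    ∃ a b : α, a < b ∧ ∀ k : ℕ, ∃ z : Fin ⌊ρ ^ k⌋₊ → α, StrictMono z ∧
      ∀ i, g^[k] (z i) = if Even (i : ℕ) then a else b := by
  obtain ⟨x, τ, hx, hτ, htrans⟩ := exists_sorted_cycle h
  obtain ⟨J, h₁, h₂⟩ := exists_swapped_interval hq0 htrans
  refine ⟨x J.castSucc, x J.succ, hx J.castSucc_lt_succ, fun k => ?_⟩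
  have hle : ⌊ρ ^ k⌋₊ ≤ ∑ i, (coverMatrix τ ^ k) i J :=
    Nat.floor_le_of_le (pow_le_sum_coverMatrix_pow hq htrans h₁ h₂ hρ1 hρ k)
  have hpos : 0 < ⌊ρ ^ k⌋₊ := Nat.floor_pos.mpr (one_le_pow₀ hρ1.le)
  obtain ⟨z, hz, hz'⟩ := (oscillatesOn_iterate hg hx hτ J k).exists_strictMono (by omega)
  exact ⟨z ∘ Fin.castLE hle, hz.comp (Fin.strictMono_castLE hle), fun i => by simp [hz']⟩

end Iterates

theorem theorem4p1
    (f : unitInterval → unitInterval) (hf : Continuous f)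
    (m p : ℕ) (hm : ∃ s : ℕ, m = 2 ^ s) (hp : Odd p) (hp1 : 1 < p)
    (hcycle : ∃ x₀ : unitInterval, Function.minimalPeriod f x₀ = m * p)
    (ρ : ℝ) (hρ1 : 1 < ρ) (hρ : ρ ^ (p - 1) - ρ ^ (p - 2) - 1 = 0) :
    ∃ a b : unitInterval, a < b ∧
      ∀ k : ℕ, 1 ≤ k →
        ∃ (x : Fin ⌊ρ ^ k⌋₊ → unitInterval) (y : Fin ⌊ρ ^ k⌋₊ → Fin 2),
          StrictMono x ∧
          (∀ i, y i = if Even (i : ℕ) then 0 else 1) ∧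
          (∀ i, f^[m * k] (x i) = if y i = 0 then a else b) ∧
          classificationError (((a : ℝ) + (b : ℝ)) / 2) x y
            (fun z => ((f^[m * k] z : unitInterval) : ℝ)) = 0 ∧
          ∀ l u : ℕ, 1 ≤ l → 1 ≤ u → (u : ℝ) ≤ ρ ^ ((k : ℝ) / (l : ℝ)) / 8 →
            ∀ G : ReLUNetwork l u,
              1 / 4 ≤ classificationError (((a : ℝ) + (b : ℝ)) / 2) x y
                (fun z => G.eval (z : ℝ)) := by
  obtain ⟨s, rfl⟩ := hm
  obtain ⟨x₀, hx₀⟩ := hcycle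
  obtain ⟨q, rfl⟩ : ∃ q, p = q + 1 := ⟨p - 1, by omega⟩
  have hm0 : 0 < 2 ^ s := by positivity
  -- Passing to `f^[m]` divides the period by `m`, which leaves the odd factor.
  have hper : Function.minimalPeriod f^[2 ^ s] x₀ = q + 1 := by
    rw [Function.minimalPeriod_iterate_eq_div_gcd hm0.ne', hx₀, Nat.gcd_mul_right_left,
      Nat.mul_div_cancel_left _ hm0]
  have hq : Even q := by
    rcases Nat.even_or_odd q with h | h
    · exact h
    · exact absurd hp (Nat.not_odd_iff_even.mpr h.add_one)
  obtain ⟨a, b, hab, H⟩ := exists_alternating_points_iterate (hf.iterate (2 ^ s)) hq (by omega) hper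
    hρ1 (by
      rw [show q + 1 - 1 = q by omega, show q + 1 - 2 = q - 1 by omega] at hρ
      linarith)
  have hab' : (a : ℝ) < b := hab
  refine ⟨a, b, hab, fun k _ => ?_⟩
  obtain ⟨x, hx, hval⟩ := H k
  rw [← Function.iterate_mul] at hval
  -- Indices start at `0`, so even `i` are the points of odd number.
  let y : Fin ⌊ρ ^ k⌋₊ → Fin 2 := fun i => if Even (i : ℕ) then 0 else 1
  have hxy : ∀ i, f^[2 ^ s * k] (x i) = if y i = 0 then a else b := fun i => by
    rw [hval]
    by_cases hi : Even (i : ℕ) <;> simp [y, hi]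
  refine ⟨x, y, hx, fun _ => rfl, hxy, ?_, fun l u hl hu hlu G => ?_⟩
  · unfold classificationError
    rw [Finset.sum_eq_zero, mul_zero]
    intro i _
    refine if_neg (not_not.mpr ?_)
    beta_reduce
    rw [hxy]
    by_cases hi : Even (i : ℕ)
    · simp only [y, hi, if_true, thresholdLabel]
      rw [if_neg (by linarith)]
    · simp only [y, hi, if_false, thresholdLabel, one_ne_zero]
      rw [if_pos (by linarith)]
  -- The bound on `u` says `8 * u ≤ ρ ^ (k / l)`; its `l`-th power gives `(8 * u) ^ l ≤ ρ ^ k`, and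
  -- an integer below `ρ ^ k` is below its floor.
  · refine one_fourth_le_classificationError hl hu (Nat.le_floor ?_) hx (fun _ => rfl) _ G
    have hρ0 : (0 : ℝ) ≤ ρ := by linarith
    push_cast
    calc (8 * (u : ℝ)) ^ l ≤ (ρ ^ ((k : ℝ) / (l : ℝ))) ^ l := by
          gcongr
          linarith
      _ = ρ ^ k := by
          rw [← Real.rpow_natCast, ← Real.rpow_mul hρ0, div_mul_cancel₀, Real.rpow_natCast]
          exact_mod_cast (by omega : l ≠ 0)
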